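/- Let $R$ be an associative ring with identity, and let $\mathrm{Mod}\text{-}R$ denote the category of unital right $R$-modules. For right $R$-modules $M$ and $N$, say that $M$ is $N$-injective if for every submodule $K\le N$ every homomorphism $K\to M$ extends to a homomorphism $N\to M$. The injectivity domain of $M$ is the class $\mathfrak{In}^{-1}(M)=\{N\in \mathrm{Mod}\text{-}R : M\text{ is }N\text{-injective}\}$. Let $i\mathcal{P}(R)$ be the collection of all classes of the form $\mathfrak{In}^{-1}(M)$ with $M\in\mathrm{Mod}\text{-}R$, ordered by inclusion; it is a complete lattice in which meets are intersections and the join of a family is the intersection of all members of $i\mathcal{P}(R)$ that contain every member of the family. Then, for every ring $R$, the lattice $i\mathcal{P}(R)$ is modular (that is, $(\mathcal A\vee \mathcal B)\wedge \mathcal C=\mathcal A\vee(\mathcal B\wedge \mathcal C)$ whenever $\mathcal A\subseteq \mathcal C$) and coatomic (that is, every element other than the greatest element $\mathrm{Mod}\text{-}R$ is contained in a coatom, a maximal element of $i\mathcal{P}(R)\setminus\{\mathrm{Mod}\text{-}R\}$). -/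

import Mathlib

universe u v

/-- `M` is `N`-injective (injective relative to `N`): every linear map from a submodule `K` of `N`
to `M` extends to `N`. -/
def RelInjective (S : Type*) [Ring S] (M N : Type*) [AddCommGroup M] [Module S M]
    [AddCommGroup N] [Module S N] : Prop :=
  ∀ (K : Submodule S N) (φ : K →ₗ[S] M), ∃ ψ : N →ₗ[S] M, ∀ x : K, ψ x = φ x

namespace RelInjective

variable {S : Type*} [Ring S] {M N P : Type*} [AddCommGroup M] [Module S M]
  [AddCommGroup N] [Module S N] [AddCommGroup P] [Module S P]

theorem of_injective (h : RelInjective S M N) (f : P →ₗ[S] N) (hf : Function.Injective f) :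
    RelInjective S M P := by
  intro K φ
  obtain ⟨ψ, hψ⟩ := h (K.map f) (φ.comp (Submodule.equivMapOfInjective f hf K).symm.toLinearMap)
  refine ⟨ψ.comp f, fun x => ?_⟩
  have h1 := hψ (Submodule.equivMapOfInjective f hf K x)
  simpa using h1

/-- Relative injectivity may be tested on cyclic submodules. -/
theorem of_cyclic
    (h : ∀ x : N, RelInjective S M (S ⧸ LinearMap.ker (LinearMap.toSpanSingleton S N x))) :
    RelInjective S M N := by
  intro K φ
  have h' : ∀ x : N, RelInjective S M (S ∙ x) := fun x =>
    (h x).of_injective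
      (((LinearMap.toSpanSingleton S N x).quotKerEquivRange.trans
        (LinearEquiv.ofEq _ _ (LinearMap.range_toSpanSingleton x))).symm.toLinearMap)
      (LinearEquiv.injective _)
  obtain ⟨m, hm, hmax⟩ := zorn_le_nonempty₀ {g : N →ₗ.[S] M | (⟨K, φ⟩ : N →ₗ.[S] M) ≤ g}
    (fun c hc hchain y hy => by
      have hd : DirectedOn (· ≤ ·) c := hchain.directedOn
      exact ⟨LinearPMap.sSup c hd, (hc hy).trans (LinearPMap.le_sSup hd hy),
        fun z hz => LinearPMap.le_sSup hd hz⟩) ⟨K, φ⟩ (le_refl (⟨K, φ⟩ : N →ₗ.[S] M))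
  have htop : m.domain = ⊤ := by
    rw [eq_top_iff]
    rintro y -
    obtain ⟨ψ, hψ⟩ := h' y (m.domain.comap (S ∙ y).subtype)
      (m.toFun.comp ((S ∙ y).subtype.restrict (fun _ hx => hx)))
    have hcompat : ∀ (a : m.domain) (b : (⟨S ∙ y, ψ⟩ : N →ₗ.[S] M).domain), (a : N) = b →
        m a = (⟨S ∙ y, ψ⟩ : N →ₗ.[S] M) b := by
      rintro ⟨a, ha⟩ ⟨b, hb⟩ hab
      have hab' : a = b := hab
      subst hab'
      exact (hψ ⟨⟨a, hb⟩, ha⟩).symm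
    have hle := hmax.2 (y := m.sup _ hcompat)
      (le_trans (show (⟨K, φ⟩ : N →ₗ.[S] M) ≤ m from hm) (LinearPMap.left_le_sup _ _ hcompat))
      (LinearPMap.left_le_sup _ _ hcompat)
    have hy2 := (LinearPMap.right_le_sup m ⟨S ∙ y, ψ⟩ hcompat).1.trans hle.1
    exact hy2 (Submodule.mem_span_singleton_self y)
  refine ⟨m.toFun.comp (LinearMap.codRestrict m.domain LinearMap.id fun x => htop ▸ trivial),
    fun x => ?_⟩
  exact (hm.2 (x := x) (y := ⟨x, htop ▸ trivial⟩) rfl).symm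

theorem iff_cyclic : RelInjective S M N ↔
    ∀ x : N, RelInjective S M (S ⧸ LinearMap.ker (LinearMap.toSpanSingleton S N x)) :=
  ⟨fun h x => h.of_injective
      ((LinearMap.range (LinearMap.toSpanSingleton S N x)).subtype.comp
        (LinearMap.toSpanSingleton S N x).quotKerEquivRange.toLinearMap)
      (Subtype.val_injective.comp (LinearEquiv.injective _)), of_cyclic⟩

theorem pi_iff {ι : Type*} {Q : ι → Type*} [∀ i, AddCommGroup (Q i)] [∀ i, Module S (Q i)] :
    RelInjective S (∀ i, Q i) N ↔ ∀ i, RelInjective S (Q i) N := by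
  constructor
  · intro h i K φ
    classical
    obtain ⟨ψ, hψ⟩ := h K ((LinearMap.single S Q i).comp φ)
    exact ⟨(LinearMap.proj i).comp ψ, fun x => by simp [hψ x]⟩
  · intro h K φ
    choose ψ hψ using fun i => h i K ((LinearMap.proj i).comp φ)
    exact ⟨LinearMap.pi ψ, fun x => funext fun i => by simp [hψ i x]⟩

end RelInjective

/-- The category of right `R`-modules; a right `R`-module is a module over the opposite ring.
The underlying types live in any universe that contains that of `R`. -/
abbrev RightMod (R : Type u) [Ring R] := ModuleCat.{max u v} Rᵐᵒᵖ

/-- The injectivity domain of a right `R`-module `M`: the class of all right `R`-modules `N` such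
that `M` is `N`-injective. -/
def injectivityDomain {R : Type u} [Ring R] (M : RightMod.{u, v} R) : Set (RightMod.{u, v} R) :=
  {N | RelInjective Rᵐᵒᵖ M N}

/-- The (right) injective profile of `R`: the collection of all injectivity domains of right
`R`-modules. -/
def IProfile (R : Type u) [Ring R] :=
  {A : Set (RightMod.{u, v} R) // ∃ M : RightMod.{u, v} R, A = injectivityDomain M}

namespace IProfile

variable {R : Type u} [Ring R]

/-- An arbitrary intersection of injectivity domains is an injectivity domain. -/
theorem exists_eq_iInter (X : Set (IProfile.{u, v} R)) :
    ∃ M : RightMod.{u, v} R, (⋂ A ∈ X, A.1) = injectivityDomain M := by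
  let F : RightMod.{u, v} R → Set (Submodule Rᵐᵒᵖ Rᵐᵒᵖ) :=
    fun M => {I | RelInjective Rᵐᵒᵖ M (Rᵐᵒᵖ ⧸ I)}
  let J := {T : Set (Submodule Rᵐᵒᵖ Rᵐᵒᵖ) // ∃ M, (∃ A ∈ X, A.1 = injectivityDomain M) ∧ F M = T}
  choose Q hQX hQF using fun j : J => j.2
  have key : ∀ (M N : RightMod.{u, v} R), N ∈ injectivityDomain M ↔
      ∀ x : N, LinearMap.ker (LinearMap.toSpanSingleton Rᵐᵒᵖ N x) ∈ F M :=
    fun M N => RelInjective.iff_cyclic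
  refine ⟨ModuleCat.of Rᵐᵒᵖ (∀ j, Q j), Set.ext fun N => ?_⟩
  have hpi : N ∈ injectivityDomain (ModuleCat.of Rᵐᵒᵖ (∀ j, Q j)) ↔
      ∀ j, N ∈ injectivityDomain (Q j) := RelInjective.pi_iff
  rw [hpi, Set.mem_iInter₂]
  constructor
  · intro h j
    obtain ⟨A, hA, hAQ⟩ := hQX j
    exact hAQ ▸ h A hA
  · intro h A hA
    obtain ⟨M, hM⟩ := A.2
    have h1 := h ⟨F M, M, ⟨A, hA, hM⟩, rfl⟩
    rw [key, hQF] at h1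
    rw [hM, key]
    exact h1

/-- Injectivity domains are ordered by inclusion. -/
instance : PartialOrder (IProfile.{u, v} R) where
  le A B := A.1 ⊆ B.1
  le_refl A := Set.Subset.refl A.1
  le_trans _ _ _ h h' := Set.Subset.trans h h'
  le_antisymm _ _ h h' := Subtype.ext (Set.Subset.antisymm h h')

/-- Infima are intersections. -/
instance : InfSet (IProfile.{u, v} R) where
  sInf X := ⟨⋂ A ∈ X, A.1, exists_eq_iInter X⟩

/-- The lattice structure of the injective profile determined by inclusion: meets are
intersections, and the join of a family is the intersection of all members of the profile that
contain it. -/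
instance : CompleteLattice (IProfile.{u, v} R) :=
  completeLatticeOfInf _ fun _ =>
    ⟨fun _ hA => Set.biInter_subset_of_mem hA, fun _ hB => Set.subset_iInter₂ fun _ hA => hB hA⟩

end IProfile

/-!
A module `M` is `N`-injective iff it is injective relative to every cyclic submodule of `N`, so the
injectivity domain of `M` is determined by the set of ideals `I` such that `M` is
`(S ⧸ I)`-injective, where `S = Rᵐᵒᵖ` and ideals of `S` are left ideals. This set is a topologizing
filter (a filter of ideals closed under `I ↦ (I : s)`), and it contains every maximal ideal since
every module is injective relative to a simple one. The point is that *every* topologizing filter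
`F` containing the maximal ideals arises in this way (`SemisimpleFilter.exists_ofModule_eq`), so
that the injective profile is isomorphic to the lattice of these filters
(`IProfile.orderIsoSemisimpleFilter`).

To separate `I ∉ F` from `F`, choose an injective module `E` and `e : E` with annihilator `I`. The
elements of `E` whose annihilator lies in `F` form a submodule `t` that does not contain `e`, so
`{s | s • e ∈ t}` lies in a maximal ideal `m`. The module `M = t + m • e` is `(S ⧸ J)`-injective for
`J ∈ F`, because extensions with values in `E` take values in `t`. It is not `(S ⧸ I)`-injective:
an extension of `m • e ⊆ M` to `S • e` sends `e` to some `y ∈ M` with `m • (y - e) = 0`; as `m ∈ F`,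
this gives `y - e ∈ t`, so that `e ∈ M`, which contradicts the choice of `m`. A product of such
modules over all `I ∉ F` realizes `F`.

In the lattice of filters, `F ⊔ G` consists of the ideals above some `I ⊓ J` with `I ∈ F` and
`J ∈ G`, and modularity follows from the modular law for ideals. Coatomicity is Zorn's lemma: the
union of a chain of filters is a filter, and it is everything only if `⊥` lies in some member.
-/

/-! ### Relative injectivity -/

namespace RelInjective

variable {S : Type*} [Ring S] {M N P : Type*} [AddCommGroup M] [Module S M]
  [AddCommGroup N] [Module S N] [AddCommGroup P] [Module S P]

theorem of_surjective (h : RelInjective S M N) (f : N →ₗ[S] P) (hf : Function.Surjective f) :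
    RelInjective S M P := by
  intro K φ
  obtain ⟨ψ, hψ⟩ := h (K.comap f) (φ.comp (f.restrict fun _ hx => hx))
  have hker : LinearMap.ker f ≤ LinearMap.ker ψ := by
    intro x hx
    have hx0 : f x = 0 := hx
    have hxK : x ∈ K.comap f := by simp [hx0]
    have h1 : (f.restrict (p := K.comap f) (q := K) fun _ hx => hx) ⟨x, hxK⟩ = 0 :=
      Subtype.ext hx0
    have h2 := hψ ⟨x, hxK⟩
    rw [LinearMap.comp_apply, h1, map_zero] at h2
    exact h2
  refine ⟨((LinearMap.ker f).liftQ ψ hker).comp (f.quotKerEquivOfSurjective hf).symm.toLinearMap,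
    ?_⟩
  rintro ⟨y, hy⟩
  obtain ⟨x, rfl⟩ := hf y
  have h1 : (f.quotKerEquivOfSurjective hf).symm (f x) = (LinearMap.ker f).mkQ x := by
    rw [LinearEquiv.symm_apply_eq]
    rfl
  have h2 := hψ ⟨x, hy⟩
  simp only [LinearMap.comp_apply, LinearEquiv.coe_coe, h1]
  exact h2

theorem prod (hN : RelInjective S M N) (hP : RelInjective S M P) : RelInjective S M (N × P) := by
  intro K φ
  -- Extend `φ` along the first factor; what remains vanishes on `K ⊓ (N × 0)` and therefore
  -- factors through the projection of `K` to `P`.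
  obtain ⟨ψ₁, h₁⟩ := hN (K.comap (LinearMap.inl S N P))
    (φ.comp ((LinearMap.inl S N P).restrict fun _ hx => hx))
  have hsub : ∀ x : K, (x : N × P).2 ∈ K.map (LinearMap.snd S N P) := fun x => ⟨x, x.2, rfl⟩
  let q : K →ₗ[S] K.map (LinearMap.snd S N P) :=
    ((LinearMap.snd S N P).comp K.subtype).codRestrict _ hsub
  have hq : Function.Surjective q := by
    rintro ⟨_, x, hx, rfl⟩
    exact ⟨⟨x, hx⟩, rfl⟩
  let δ : K →ₗ[S] M := φ - ψ₁.comp ((LinearMap.fst S N P).comp K.subtype)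
  have hδ : LinearMap.ker q ≤ LinearMap.ker δ := by
    rintro ⟨⟨a, b⟩, hx⟩ hxq
    obtain rfl : b = 0 := congrArg Subtype.val (LinearMap.mem_ker.1 hxq)
    exact sub_eq_zero.2 (h₁ ⟨a, hx⟩).symm
  obtain ⟨ψ₂, h₂⟩ := hP (K.map (LinearMap.snd S N P))
    (((LinearMap.ker q).liftQ δ hδ).comp (q.quotKerEquivOfSurjective hq).symm.toLinearMap)
  refine ⟨ψ₁.coprod ψ₂, fun x => ?_⟩
  have h3 : (q.quotKerEquivOfSurjective hq).symm (q x) = (LinearMap.ker q).mkQ x := by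
    rw [LinearEquiv.symm_apply_eq]
    rfl
  have h4 : ψ₂ (x : N × P).2 = δ x := by
    refine (h₂ (q x)).trans ?_
    simp only [LinearMap.comp_apply, LinearEquiv.coe_coe, h3]
    rfl
  rw [LinearMap.coprod_apply, h4]
  exact add_sub_cancel (ψ₁ (x : N × P).1) (φ x)

theorem of_isSimpleModule [IsSimpleModule S N] : RelInjective S M N := by
  intro K φ
  obtain rfl | rfl := eq_bot_or_eq_top K
  · refine ⟨0, fun x => ?_⟩
    rw [Subsingleton.elim x 0]
    simp
  · exact ⟨φ.comp (LinearMap.id.codRestrict ⊤ fun _ => trivial), fun _ => rfl⟩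

end RelInjective

theorem Module.Baer.relInjective {S : Type*} [Ring S] {E N : Type*} [AddCommGroup E] [Module S E]
    [AddCommGroup N] [Module S N] (h : Module.Baer S E) : RelInjective S E N := by
  intro K φ
  obtain ⟨ψ, hψ⟩ := h.extension_property K.subtype K.injective_subtype φ
  exact ⟨ψ, fun x => LinearMap.congr_fun hψ x⟩

/-- Every cyclic module `S ⧸ I` embeds in an injective module; the embedding is recorded by the
image `e` of the generator. -/
theorem exists_baer_ker_toSpanSingleton_eq {S : Type u} [Ring S] (I : Ideal S) :
    ∃ (E : ModuleCat.{max u v} S) (e : E), Module.Baer S E ∧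
      LinearMap.ker (LinearMap.toSpanSingleton S E e) = I := by
  have : CategoryTheory.EnoughInjectives (ModuleCat.{max u v} S) :=
    ModuleCat.enoughInjectives.{v, u} S
  let Q : ModuleCat.{max u v} S := ModuleCat.of S (ULift.{v} (S ⧸ I))
  let E : ModuleCat.{max u v} S := CategoryTheory.Injective.under Q
  let ι : Q ⟶ E := CategoryTheory.Injective.ι Q
  have hι : Function.Injective ι := (ModuleCat.mono_iff_injective ι).1 inferInstance
  refine ⟨E, ι (ULift.up (I.mkQ 1)), ?_, ?_⟩
  · have : CategoryTheory.Injective (ModuleCat.of S E) :=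
      CategoryTheory.Injective.injective_under Q
    exact Module.Baer.of_injective (Module.injective_module_of_injective_object S E)
  · ext s
    have h : s • (ULift.up (I.mkQ 1) : Q) = ULift.up (I.mkQ s) := by
      refine ULift.ext _ _ ?_
      change s • I.mkQ 1 = I.mkQ s
      rw [← map_smul, smul_eq_mul, mul_one]
    rw [LinearMap.mem_ker, LinearMap.toSpanSingleton_apply, ← map_smul,
      map_eq_zero_iff ι.hom hι, h, ← Submodule.Quotient.mk_eq_zero I]
    exact ULift.ext_iff

/-! ### Topologizing filters containing the maximal ideals -/

/-- A topologizing filter (linear topology) of left ideals of `S` that contains every maximal left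
ideal. These filters correspond to the hereditary pretorsion classes of `S`-modules containing all
semisimple modules. The ideal `(I : s) = {a | a * s ∈ I}` is encoded as the preimage of `I` under
right multiplication by `s`. -/
@[ext] structure SemisimpleFilter (S : Type*) [Ring S] where
  carrier : Set (Ideal S)
  top_mem : ⊤ ∈ carrier
  mem_of_le : ∀ {I J : Ideal S}, I ∈ carrier → I ≤ J → J ∈ carrier
  inf_mem : ∀ {I J : Ideal S}, I ∈ carrier → J ∈ carrier → I ⊓ J ∈ carrier
  comap_mem : ∀ {I : Ideal S} (s : S), I ∈ carrier →
    Submodule.comap (LinearMap.toSpanSingleton S S s) I ∈ carrier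
  mem_of_isMaximal : ∀ {I : Ideal S}, I.IsMaximal → I ∈ carrier

namespace SemisimpleFilter

variable {S : Type*} [Ring S]

instance : PartialOrder (SemisimpleFilter S) where
  le F G := F.carrier ⊆ G.carrier
  le_refl F := Set.Subset.refl F.carrier
  le_trans _ _ _ h h' := Set.Subset.trans h h'
  le_antisymm _ _ h h' := SemisimpleFilter.ext (Set.Subset.antisymm h h')

instance : OrderTop (SemisimpleFilter S) where
  top := ⟨Set.univ, trivial, fun _ _ => trivial, fun _ _ => trivial, fun _ _ => trivial,
    fun _ => trivial⟩
  le_top F := Set.subset_univ F.carrier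

/-- The join of `F` and `G` consists of the ideals above `I ⊓ J` for some `I ∈ F` and `J ∈ G`. -/
instance : Lattice (SemisimpleFilter S) where
  sup F G :=
    { carrier := {H | ∃ I ∈ F.carrier, ∃ J ∈ G.carrier, I ⊓ J ≤ H}
      top_mem := ⟨⊤, F.top_mem, ⊤, G.top_mem, le_top⟩
      mem_of_le := fun ⟨I, hI, J, hJ, h⟩ h' => ⟨I, hI, J, hJ, h.trans h'⟩
      inf_mem := fun ⟨I, hI, J, hJ, h⟩ ⟨I', hI', J', hJ', h'⟩ =>
        ⟨I ⊓ I', F.inf_mem hI hI', J ⊓ J', G.inf_mem hJ hJ',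
          (inf_inf_inf_comm I I' J J').le.trans (inf_le_inf h h')⟩
      comap_mem := fun s ⟨I, hI, J, hJ, h⟩ =>
        ⟨_, F.comap_mem s hI, _, G.comap_mem s hJ, fun _ ha => h ha⟩
      mem_of_isMaximal := fun hI => ⟨_, F.mem_of_isMaximal hI, ⊤, G.top_mem, inf_le_left⟩ }
  le_sup_left F G := fun I hI => ⟨I, hI, ⊤, G.top_mem, inf_le_left⟩
  le_sup_right F G := fun J hJ => ⟨⊤, F.top_mem, J, hJ, inf_le_right⟩
  sup_le F G K hF hG := by
    rintro H ⟨I, hI, J, hJ, h⟩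
    exact K.mem_of_le (K.inf_mem (hF hI) (hG hJ)) h
  inf F G :=
    { carrier := F.carrier ∩ G.carrier
      top_mem := ⟨F.top_mem, G.top_mem⟩
      mem_of_le := fun hI h => ⟨F.mem_of_le hI.1 h, G.mem_of_le hI.2 h⟩
      inf_mem := fun hI hJ => ⟨F.inf_mem hI.1 hJ.1, G.inf_mem hI.2 hJ.2⟩
      comap_mem := fun s hI => ⟨F.comap_mem s hI.1, G.comap_mem s hI.2⟩
      mem_of_isMaximal := fun hI => ⟨F.mem_of_isMaximal hI, G.mem_of_isMaximal hI⟩ }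
  inf_le_left _ _ := Set.inter_subset_left
  inf_le_right _ _ := Set.inter_subset_right
  le_inf _ _ _ := Set.subset_inter

instance : IsModularLattice (SemisimpleFilter S) where
  sup_inf_le_assoc_of_le {F} G {K} hFK := by
    rintro H ⟨⟨I, hI, J, hJ, hIJ⟩, hH⟩
    -- `J ⊔ (H ⊓ I)` lies in `G` because of `J` and in `K` because of `H ⊓ I`.
    refine ⟨I, hI, J ⊔ H ⊓ I, ⟨G.mem_of_le hJ le_sup_left,
      K.mem_of_le (K.inf_mem hH (hFK hI)) le_sup_right⟩, ?_⟩
    rw [inf_comm, sup_comm, sup_inf_assoc_of_le J inf_le_right]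
    exact sup_le inf_le_left (inf_comm J I ▸ hIJ)

theorem eq_top_of_bot_mem {F : SemisimpleFilter S} (h : ⊥ ∈ F.carrier) : F = ⊤ :=
  top_unique fun _ _ => F.mem_of_le h bot_le

instance : IsCoatomic (SemisimpleFilter S) := by
  refine IsCoatomic.of_isChain_bounded fun c hc ⟨F₀, hF₀⟩ htop => ?_
  let U : SemisimpleFilter S :=
    { carrier := {I | ∃ F ∈ c, I ∈ F.carrier}
      top_mem := ⟨F₀, hF₀, F₀.top_mem⟩
      mem_of_le := fun ⟨F, hF, hI⟩ h => ⟨F, hF, F.mem_of_le hI h⟩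
      inf_mem := by
        rintro I J ⟨F, hF, hI⟩ ⟨G, hG, hJ⟩
        obtain h | h := hc.total hF hG
        · exact ⟨G, hG, G.inf_mem (h hI) hJ⟩
        · exact ⟨F, hF, F.inf_mem hI (h hJ)⟩
      comap_mem := fun s ⟨F, hF, hI⟩ => ⟨F, hF, F.comap_mem s hI⟩
      mem_of_isMaximal := fun hI => ⟨F₀, hF₀, F₀.mem_of_isMaximal hI⟩ }
  refine ⟨U, fun hU => ?_, fun F hF I hI => ⟨F, hF, hI⟩⟩
  have hbot : (⊥ : Ideal S) ∈ U.carrier := hU ▸ trivial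
  obtain ⟨F, hF, h⟩ := hbot
  exact htop (eq_top_of_bot_mem h ▸ hF)

/-! ### The filter of a module -/

/-- The filter of all `I` such that `M` is injective relative to `S ⧸ I`. -/
def ofModule (S : Type*) [Ring S] (M : Type*) [AddCommGroup M] [Module S M] :
    SemisimpleFilter S where
  carrier := {I | RelInjective S M (S ⧸ I)}
  top_mem := fun K φ => ⟨0, fun x => by rw [Subsingleton.elim x 0]; simp⟩
  mem_of_le := fun hI h => hI.of_surjective (Submodule.factor h) (Submodule.factor_surjective h)
  inf_mem := fun {I J} hI hJ =>
    (hI.prod hJ).of_injective ((I ⊓ J).liftQ (I.mkQ.prod J.mkQ) (by simp [LinearMap.ker_prod]))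
      (LinearMap.ker_eq_bot.1 (Submodule.ker_liftQ_eq_bot _ _ _ (by simp [LinearMap.ker_prod])))
  comap_mem := fun {I} s hI => by
    have h := RelInjective.iff_cyclic.1 hI (I.mkQ s)
    have hker : LinearMap.ker (LinearMap.toSpanSingleton S (S ⧸ I) (I.mkQ s)) =
        Submodule.comap (LinearMap.toSpanSingleton S S s) I := by
      ext a
      simp [← Submodule.Quotient.mk_smul, Submodule.Quotient.mk_eq_zero]
    rwa [hker] at h
  mem_of_isMaximal := fun {I} hI => by
    have : IsSimpleModule S (S ⧸ I) := isSimpleModule_iff_isCoatom.2 hI.out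
    exact RelInjective.of_isSimpleModule

/-- The `F`-torsion submodule of `E`: the elements whose annihilator belongs to `F`. -/
def torsion (F : SemisimpleFilter S) (E : Type*) [AddCommGroup E] [Module S E] :
    Submodule S E where
  carrier := {x | LinearMap.ker (LinearMap.toSpanSingleton S E x) ∈ F.carrier}
  zero_mem' := F.mem_of_le F.top_mem fun a _ => by simp
  add_mem' := fun {x y} hx hy => F.mem_of_le (F.inf_mem hx hy) fun a ha => by
    have h1 : a • x = 0 := ha.1
    have h2 : a • y = 0 := ha.2
    simp [h1, h2]
  smul_mem' := fun s x hx => F.mem_of_le (F.comap_mem s hx) fun a ha => by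
    have h1 : (a * s) • x = 0 := ha
    simpa [mul_smul] using h1

theorem mem_torsion {F : SemisimpleFilter S} {E : Type*} [AddCommGroup E] [Module S E] {x : E} :
    x ∈ F.torsion E ↔ LinearMap.ker (LinearMap.toSpanSingleton S E x) ∈ F.carrier := Iff.rfl

/-- A submodule of an injective module that contains the `F`-torsion submodule is injective relative
to `S ⧸ J` for all `J ∈ F`. -/
theorem le_ofModule_of_torsion_le {F : SemisimpleFilter S} {E : Type*} [AddCommGroup E] [Module S E]
    (hE : Module.Baer S E) {M : Submodule S E} (hM : F.torsion E ≤ M) : F ≤ ofModule S M := by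
  intro J hJ K φ
  obtain ⟨ψ, hψ⟩ := hE.relInjective K (M.subtype.comp φ)
  have hψM : ∀ x, ψ x ∈ M := by
    intro x
    obtain ⟨s, rfl⟩ := J.mkQ_surjective x
    refine hM (F.mem_of_le (F.comap_mem s hJ) fun a ha => ?_)
    have h1 : a • J.mkQ s = 0 := by
      rw [← map_smul]
      exact (Submodule.Quotient.mk_eq_zero J).2 ha
    rw [LinearMap.mem_ker, LinearMap.toSpanSingleton_apply, ← map_smul, h1, map_zero]
  exact ⟨ψ.codRestrict M hψM, fun x => Subtype.ext (hψ x)⟩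

/-- The separating module is `torsion F E + m • e`, for an injective module `E`, an element `e` of
annihilator `I`, and a maximal ideal `m` containing `{s | s • e ∈ torsion F E}`. -/
theorem exists_le_ofModule_notMem {S : Type u} [Ring S] (F : SemisimpleFilter S) {I : Ideal S}
    (hI : I ∉ F.carrier) :
    ∃ M : ModuleCat.{max u v} S, F ≤ ofModule S M ∧ I ∉ (ofModule S M).carrier := by
  obtain ⟨E, e, hE, rfl⟩ := exists_baer_ker_toSpanSingleton_eq.{u, v} I
  let g := LinearMap.toSpanSingleton S E e
  have hne : (F.torsion E).comap g ≠ ⊤ := fun h => by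
    have h1 : (1 : S) ∈ (F.torsion E).comap g := h ▸ trivial
    exact hI (mem_torsion.1 (by simpa [g] using h1))
  obtain ⟨m, hm, hle⟩ := Ideal.exists_le_maximal _ hne
  let M : Submodule S E := F.torsion E ⊔ Submodule.map g m
  have heM : e ∉ M := by
    intro he
    obtain ⟨t, ht, _, ⟨a, ha, rfl⟩, hta⟩ := Submodule.mem_sup.1 he
    have h1 : (1 - a) ∈ m := hle <| by
      have h2 : g (1 - a) = t := by
        simp only [g, LinearMap.toSpanSingleton_apply, sub_smul, one_smul] at hta ⊢
        exact sub_eq_of_eq_add hta.symm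
      exact Submodule.mem_comap.2 (h2 ▸ ht)
    exact hm.ne_top (Ideal.eq_top_iff_one m |>.2 (by simpa using m.add_mem h1 ha))
  refine ⟨ModuleCat.of S M, le_ofModule_of_torsion_le hE le_sup_left, fun h => heM ?_⟩
  have hspan : RelInjective S M (LinearMap.range g) :=
    RelInjective.of_injective h g.quotKerEquivRange.symm.toLinearMap (LinearEquiv.injective _)
  obtain ⟨ψ, hψ⟩ := hspan (M.comap (LinearMap.range g).subtype)
    ((LinearMap.range g).subtype.restrict fun _ hx => hx)
  let y : M := ψ (g.rangeRestrict 1)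
  have hy : (y : E) - e ∈ F.torsion E := by
    refine F.mem_of_le (F.mem_of_isMaximal hm) fun a ha => ?_
    have haM : g a ∈ M := Submodule.mem_sup_right ⟨a, ha, rfl⟩
    have h1 : (ψ (g.rangeRestrict a) : E) = g a :=
      congrArg Subtype.val (hψ ⟨g.rangeRestrict a, haM⟩)
    have h2 : g.rangeRestrict a = a • g.rangeRestrict 1 := by
      rw [← map_smul, smul_eq_mul, mul_one]
    rw [h2, map_smul] at h1
    have h3 : a • (y : E) = a • e := h1
    rw [LinearMap.mem_ker, LinearMap.toSpanSingleton_apply, smul_sub, h3, sub_self]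
  have := M.sub_mem y.2 (Submodule.mem_sup_left hy)
  rwa [sub_sub_cancel] at this

/-- A filter is realized by the product of modules separating it from the ideals outside it. -/
theorem exists_ofModule_eq {S : Type u} [Ring S] (F : SemisimpleFilter S) :
    ∃ M : ModuleCat.{max u v} S, ofModule S M = F := by
  choose Q hle hQ using fun I : {I : Ideal S // I ∉ F.carrier} =>
    exists_le_ofModule_notMem.{u, v} F I.2
  refine ⟨ModuleCat.of S (∀ I, Q I), le_antisymm (fun I hI => ?_) fun I hI => ?_⟩
  · by_contra h
    exact hQ ⟨I, h⟩ (RelInjective.pi_iff.1 hI ⟨I, h⟩)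
  · exact RelInjective.pi_iff.2 fun J => hle J hI

theorem relInjective_iff {M N : Type*} [AddCommGroup M] [Module S M] [AddCommGroup N] [Module S N] :
    RelInjective S M N ↔
      ∀ x : N, LinearMap.ker (LinearMap.toSpanSingleton S N x) ∈ (ofModule S M).carrier :=
  RelInjective.iff_cyclic

end SemisimpleFilter

/-! ### The injective profile as a lattice of filters -/

namespace IProfile

open SemisimpleFilter

variable {R : Type u} [Ring R]

theorem injectivityDomain_subset_iff {M N : RightMod.{u, v} R} :
    injectivityDomain M ⊆ injectivityDomain N ↔ ofModule Rᵐᵒᵖ M ≤ ofModule Rᵐᵒᵖ N := by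
  constructor
  · intro h I hI
    -- `Rᵐᵒᵖ ⧸ I` has to be lifted to the universe of the modules.
    let e : ULift.{v} (Rᵐᵒᵖ ⧸ I) ≃ₗ[Rᵐᵒᵖ] Rᵐᵒᵖ ⧸ I := ULift.moduleEquiv
    have h1 : ModuleCat.of Rᵐᵒᵖ (ULift.{v} (Rᵐᵒᵖ ⧸ I)) ∈ injectivityDomain M :=
      RelInjective.of_injective hI e.toLinearMap e.injective
    exact RelInjective.of_injective (h h1) e.symm.toLinearMap e.symm.injective
  · intro h P hP
    exact relInjective_iff.2 fun x => h (relInjective_iff.1 hP x)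

/-- The injective profile is isomorphic to the lattice of topologizing filters that contain the
maximal ideals, by sending the injectivity domain of `M` to the filter of `M`. -/
noncomputable def orderIsoSemisimpleFilter :
    IProfile.{u, v} R ≃o SemisimpleFilter Rᵐᵒᵖ :=
  RelIso.ofSurjective
    (OrderEmbedding.ofMapLEIff (fun A : IProfile.{u, v} R => ofModule Rᵐᵒᵖ A.2.choose) fun A B => by
      rw [← injectivityDomain_subset_iff, ← A.2.choose_spec, ← B.2.choose_spec]
      rfl)
    fun F => by
      obtain ⟨M, rfl⟩ := exists_ofModule_eq.{u, v} F
      let A : IProfile.{u, v} R := ⟨injectivityDomain M, M, rfl⟩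
      have hA : injectivityDomain M = injectivityDomain A.2.choose := A.2.choose_spec
      exact ⟨A, le_antisymm (injectivityDomain_subset_iff.1 hA.ge)
        (injectivityDomain_subset_iff.1 hA.le)⟩

end IProfile

theorem corollary2p7 (R : Type u) [Ring R] :
    IsModularLattice (IProfile.{u, v} R) ∧ IsCoatomic (IProfile.{u, v} R) := by
  let f := IProfile.orderIsoSemisimpleFilter.{u, v} (R := R)
  refine ⟨⟨fun {A} B {C} hAC => f.le_iff_le.1 ?_⟩, f.isCoatomic_iff.2 inferInstance⟩
  simp only [map_sup, map_inf]
  exact sup_inf_le_assoc_of_le (f B) (f.le_iff_le.2 hAC)
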